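/- Let $\ell$ be an odd prime, let $F$ be a quadratic number field with discriminant $\Delta_F$, and let $K$ be a finite extension of $F$ such that either (a) $[K:F]=\ell$ and $K/\mathbb{Q}$ is a Galois extension whose Galois group is the dihedral group of order $2\ell$; or (b) $\ell$ divides the class number of $F$, and $K/F$ is an unramified abelian extension of degree $\ell^n$ for some integer $n\ge 1$. Let $p$ and $q$ be distinct odd (positive) primes such that the Legendre symbol $\left(\frac{p}{q}\right)=-1$ and such that $p\equiv 1\pmod 4$ or $q\equiv 1\pmod 4$. Let $H_K(p,q)$ be the quaternion algebra over $K$ generated by $i,j$ with relations $i^2=p$, $j^2=q$, $ij=-ji$. Then $H_K(p,q)$ is a division algebra if and only if $\left(\frac{\Delta_F}{p}\right)=1$ or $\left(\frac{\Delta_F}{q}\right)=1$ (Legendre symbols). -/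

import Mathlib

open scoped NumberField Quaternion

/-- An algebra (or ring) `A` is a division algebra if `A ≠ 0` and, for all `a ≠ 0` and all `b`, the
equations `a * x = b` and `y * a = b` have unique solutions. -/
def IsDivisionAlgebra (A : Type*) [Ring A] : Prop :=
  Nontrivial A ∧ ∀ a : A, a ≠ 0 → ∀ b : A, (∃! x, a * x = b) ∧ (∃! y, y * a = b)

/-- `K ⊇ F` is a dihedral extension of `ℚ` of degree `ℓ` over `F`: `K / ℚ` is Galois with Galois
group the dihedral group of order `2ℓ`, and `[K : F] = ℓ`. -/
structure IsDihedralOver (ℓ : ℕ) (F K : Type*) [Field F] [NumberField F] [Field K] [NumberField K]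
    [Algebra F K] : Prop where
  isGalois : IsGalois ℚ K
  dihedral : Nonempty (Gal(K/ℚ) ≃* DihedralGroup ℓ)
  degree : Module.finrank F K = ℓ

/-- `ℓ` divides the class number of `F`, and `K / F` is an unramified abelian extension of degree
`ℓ ^ n` with `n ≥ 1`. Unramified means unramified at all nonzero primes of the ring of integers
of `K`; since `K / F` is Galois, for odd `ℓ` it is then unramified at the infinite places too. -/
structure IsUnramifiedAbelianOver (ℓ : ℕ) (F K : Type*) [Field F] [NumberField F] [Field K]
    [NumberField K] [Algebra F K] : Prop where
  dvd_classNumber : ℓ ∣ NumberField.classNumber F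
  isAbelianGalois : IsAbelianGalois F K
  degree : ∃ n : ℕ, 1 ≤ n ∧ Module.finrank F K = ℓ ^ n
  unramified : ∀ (P : Ideal (𝓞 K)) [P.IsPrime], P ≠ ⊥ → Algebra.IsUnramifiedAt (𝓞 F) P

open scoped NumberTheorySymbols

/-! Over `ℚ` the quaternion algebra `(p, q)` is ramified exactly at `p` and `q`, so a quadratic
field `F` fails to split it exactly when `p` or `q` splits in `F`; an extension of odd degree
changes nothing. The argument is phrased through the norm form `⟨1, -p, -q, pq⟩`: the algebra is a
division algebra iff this form is anisotropic (`isDivisionAlgebra_iff_not_isotropicNorm`).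

In both cases (a) and (b) the degree `[K : F]` is odd, and Springer's theorem (`springer_diagonal`)
moves anisotropy between `K` and `F`. Write `F = ℚ(√d)` with `d` squarefree; `d` and the
discriminant have the same Legendre symbols at odd primes (`legendreSym_discr`).

If `d` is a nonzero square modulo `p`, then `F` embeds in `ℚ_p` by Hensel, and there the form is
anisotropic since `q` is not a square modulo `p` (`not_isotropicNorm_padic`). The same holds with
`p` and `q` exchanged.

Otherwise a zero over `F` comes from representing `d` by `⟨p, q, -pq⟩` over `ℚ`: then `√d·w + xi +
yj + zk` has norm zero. This local-global statement for four variables is proved as in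
Hasse–Minkowski: the form is cut into two binary halves, and Dirichlet's theorem supplies a prime
`r` such that `±r` links them. Each half then gives a ternary form to which Legendre's theorem
applies (`exists_linked_conics`); quadratic reciprocity takes care of the condition at `r`. -/

/-! ### Legendre's theorem on ternary forms -/

theorem Nat.exists_sq_lt_le_succ_sq {n : ℕ} (hn : 0 < n) :
    ∃ X : ℕ, X ^ 2 < n ∧ n ≤ (X + 1) ^ 2 := by
  refine ⟨Nat.sqrt (n - 1), ?_, ?_⟩
  · have := Nat.sqrt_le' (n - 1); omega
  · have := Nat.lt_succ_sqrt' (n - 1)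
    rw [Nat.succ_eq_add_one] at this; omega

/-- Pigeonhole principle: a homomorphism from `ℤ³` to a finite group of order less than the number
of points of a box has a small nonzero element in its kernel. -/
theorem exists_small_mem_ker {G : Type*} [AddCommGroup G] [Fintype G] (φ : ℤ × ℤ × ℤ →+ G)
    (X Y Z : ℕ) (h : Fintype.card G < (X + 1) * ((Y + 1) * (Z + 1))) :
    ∃ x y z : ℤ, ¬(x = 0 ∧ y = 0 ∧ z = 0) ∧ φ (x, y, z) = 0 ∧
      x ^ 2 ≤ (X : ℤ) ^ 2 ∧ y ^ 2 ≤ (Y : ℤ) ^ 2 ∧ z ^ 2 ≤ (Z : ℤ) ^ 2 := by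
  let g : Fin (X + 1) × Fin (Y + 1) × Fin (Z + 1) → G :=
    fun t => φ ((t.1 : ℕ), (t.2.1 : ℕ), (t.2.2 : ℕ))
  obtain ⟨⟨x, y, z⟩, ⟨x', y', z'⟩, hne, heq⟩ :=
    Fintype.exists_ne_map_eq_of_card_lt g (by simpa using h)
  have sq (N : ℕ) (u v : Fin (N + 1)) : ((u : ℕ) - (v : ℕ) : ℤ) ^ 2 ≤ (N : ℤ) ^ 2 := by
    apply sq_le_sq'
    · have := u.2; have := v.2; omega
    · have := u.2; have := v.2; omega
  refine ⟨(x : ℕ) - (x' : ℕ), (y : ℕ) - (y' : ℕ), (z : ℕ) - (z' : ℕ), ?_, ?_, sq _ _ _, sq _ _ _,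
    sq _ _ _⟩
  · rintro ⟨h1, h2, h3⟩
    apply hne
    ext <;> simp <;> omega
  · have := sub_eq_zero.2 heq
    simpa only [g, ← map_sub, Prod.mk_sub_mk] using this

/-- Legendre's theorem on ternary quadratic forms. -/
theorem legendre_ternary_pos (a b c : ℕ) (ha : 0 < a) (hb : 0 < b) (hc : 0 < c)
    (hab : a.Coprime b) (hac : a.Coprime c) (hbc : b.Coprime c)
    (h1 : ∃ k : ℤ, (a : ℤ) ∣ k ^ 2 - b * c) (h2 : ∃ k : ℤ, (b : ℤ) ∣ k ^ 2 - a * c)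
    (h3 : ∃ k : ℤ, (c : ℤ) ∣ k ^ 2 + a * b) :
    ∃ x y z : ℤ, ¬(x = 0 ∧ y = 0 ∧ z = 0) ∧ (a : ℤ) * x ^ 2 + b * y ^ 2 = c * z ^ 2 := by
  have : NeZero a := ⟨ha.ne'⟩
  have : NeZero b := ⟨hb.ne'⟩
  have : NeZero c := ⟨hc.ne'⟩
  obtain ⟨X, hX, hX'⟩ := Nat.exists_sq_lt_le_succ_sq (Nat.mul_pos hb hc)
  obtain ⟨Y, hY, hY'⟩ := Nat.exists_sq_lt_le_succ_sq (Nat.mul_pos ha hc)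
  obtain ⟨Z, hZ, hZ'⟩ := Nat.exists_sq_lt_le_succ_sq (Nat.mul_pos ha hb)
  -- The pigeonhole count must be strict. Equality here means that `a * c` is a square, and then
  -- there is an explicit zero with `y = 0`.
  by_cases hsq : (Y + 1) ^ 2 = a * c
  · refine ⟨c, 0, (Y + 1 : ℕ), by simp [hc.ne'], ?_⟩
    have : (((Y + 1 : ℕ) : ℤ)) ^ 2 = a * c := by exact_mod_cast hsq
    rw [this]; ring
  have hcard : a * (b * c) < (X + 1) * ((Y + 1) * (Z + 1)) := by
    have hY'' : a * c < (Y + 1) ^ 2 := lt_of_le_of_ne hY' (Ne.symm hsq)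
    refine lt_of_pow_lt_pow_left₀ 2 (Nat.zero_le _) ?_
    calc (a * (b * c)) ^ 2 = (b * c) * ((a * c) * (a * b)) := by ring
      _ < (b * c) * ((Y + 1) ^ 2 * (a * b)) := by gcongr
      _ ≤ (X + 1) ^ 2 * ((Y + 1) ^ 2 * (Z + 1) ^ 2) := by gcongr
      _ = _ := by ring
  obtain ⟨k, hk⟩ := h1
  obtain ⟨l, hl⟩ := h2
  obtain ⟨m, hm⟩ := h3
  -- Modulo `a`, `b * (b y² - c z²) = (b y - k z)(b y + k z)`, so one linear congruence makes the
  -- form divisible by `a`; likewise modulo `b` and `c`. The kernel of `φ` imposes all three.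
  let φ : ℤ × ℤ × ℤ →+ ZMod a × ZMod b × ZMod c :=
    { toFun := fun t => ((b : ZMod a) * (t.2.1 : ℤ) - k * (t.2.2 : ℤ),
        (a : ZMod b) * (t.1 : ℤ) - l * (t.2.2 : ℤ), (a : ZMod c) * (t.1 : ℤ) - m * (t.2.1 : ℤ))
      map_zero' := by simp
      map_add' := fun s t => by
        simp only [Prod.fst_add, Prod.snd_add, Int.cast_add, Prod.mk_add_mk, Prod.mk.injEq]
        refine ⟨?_, ?_, ?_⟩ <;> ring }
  obtain ⟨x, y, z, hne, hφ, hx, hy, hz⟩ := exists_small_mem_ker φ X Y Z (by simpa using hcard)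
  have e1 : (b : ZMod a) * (y : ℤ) - k * (z : ℤ) = 0 := congrArg Prod.fst hφ
  have e2 : (a : ZMod b) * (x : ℤ) - l * (z : ℤ) = 0 := congrArg (fun t => t.2.1) hφ
  have e3 : (a : ZMod c) * (x : ℤ) - m * (y : ℤ) = 0 := congrArg (fun t => t.2.2) hφ
  rw [← ZMod.intCast_zmod_eq_zero_iff_dvd] at hk hl hm
  push_cast at hk hl hm
  have d1 : (a : ℤ) ∣ a * x ^ 2 + b * y ^ 2 - c * z ^ 2 := by
    rw [← ZMod.intCast_zmod_eq_zero_iff_dvd]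
    have hu : IsUnit (b : ZMod a) := (ZMod.isUnit_iff_coprime b a).2 hab.symm
    apply hu.mul_left_cancel
    push_cast
    rw [ZMod.natCast_self]
    linear_combination (b * (y : ZMod a) + k * z) * e1 + z ^ 2 * hk
  have d2 : (b : ℤ) ∣ a * x ^ 2 + b * y ^ 2 - c * z ^ 2 := by
    rw [← ZMod.intCast_zmod_eq_zero_iff_dvd]
    have hu : IsUnit (a : ZMod b) := (ZMod.isUnit_iff_coprime a b).2 hab
    apply hu.mul_left_cancel
    push_cast
    rw [ZMod.natCast_self]
    linear_combination (a * (x : ZMod b) + l * z) * e2 + z ^ 2 * hl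
  have d3 : (c : ℤ) ∣ a * x ^ 2 + b * y ^ 2 - c * z ^ 2 := by
    rw [← ZMod.intCast_zmod_eq_zero_iff_dvd]
    have hu : IsUnit (a : ZMod c) := (ZMod.isUnit_iff_coprime a c).2 hac
    apply hu.mul_left_cancel
    push_cast
    rw [ZMod.natCast_self]
    linear_combination (a * (x : ZMod c) + m * y) * e3 + y ^ 2 * hm
  have dvd : ((a : ℤ) * (b * c)) ∣ a * x ^ 2 + b * y ^ 2 - c * z ^ 2 := by
    apply IsCoprime.mul_dvd _ d1 (IsCoprime.mul_dvd (Nat.isCoprime_iff_coprime.2 hbc) d2 d3)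
    exact IsCoprime.mul_right (Nat.isCoprime_iff_coprime.2 hab) (Nat.isCoprime_iff_coprime.2 hac)
  obtain ⟨t, ht⟩ := dvd
  have hX2 : x ^ 2 < (b : ℤ) * c := lt_of_le_of_lt hx (by exact_mod_cast hX)
  have hY2 : y ^ 2 < (a : ℤ) * c := lt_of_le_of_lt hy (by exact_mod_cast hY)
  have hZ2 : z ^ 2 < (a : ℤ) * b := lt_of_le_of_lt hz (by exact_mod_cast hZ)
  have ha' : (0 : ℤ) < a := by exact_mod_cast ha
  have hb' : (0 : ℤ) < b := by exact_mod_cast hb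
  have hc' : (0 : ℤ) < c := by exact_mod_cast hc
  have habc : (0 : ℤ) < a * (b * c) := by positivity
  have i1 := mul_lt_mul_of_pos_left hX2 ha'
  have i2 := mul_lt_mul_of_pos_left hY2 hb'
  have i3 := mul_lt_mul_of_pos_left hZ2 hc'
  have j1 : 0 ≤ (a : ℤ) * x ^ 2 := by positivity
  have j2 : 0 ≤ (b : ℤ) * y ^ 2 := by positivity
  have j3 : 0 ≤ (c : ℤ) * z ^ 2 := by positivity
  have t1 : -1 < t := by
    refine lt_of_mul_lt_mul_left ?_ habc.le
    rw [← ht]; linarith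
  have t2 : t < 2 := by
    refine lt_of_mul_lt_mul_left ?_ habc.le
    rw [← ht]; linarith
  -- The box bounds put the form strictly between `-abc` and `2abc`, and it is a multiple of `abc`.
  have : t = 0 ∨ t = 1 := by omega
  rcases this with rfl | rfl
  · exact ⟨x, y, z, hne, by linarith⟩
  -- Since `a x² + b y² = c (z² + ab)`, multiplying by `z² + ab`, a value of the norm form `⟨1,
  -- ab⟩`, and composing gives the value `c (z² + ab)²`.
  · refine ⟨x * z + b * y, y * z - a * x, z ^ 2 + a * b, ?_, ?_⟩
    · rintro ⟨-, -, h⟩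
      have : 0 < z ^ 2 + (a : ℤ) * b := by positivity
      exact this.ne' h
    · linear_combination (z ^ 2 + (a : ℤ) * b) * ht

/-- Legendre's theorem for an indefinite form `A x² = B y² + C z²` with `B > 0`. -/
theorem legendre_ternary (A B C : ℤ) (hA : A ≠ 0) (hB : 0 < B) (hC : C ≠ 0)
    (hsign : 0 < A ∨ C < 0) (hAB : IsCoprime A B) (hAC : IsCoprime A C) (hBC : IsCoprime B C)
    (h1 : ∃ k, A ∣ k ^ 2 + B * C) (h2 : ∃ k, B ∣ k ^ 2 - A * C) (h3 : ∃ k, C ∣ k ^ 2 - A * B) :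
    ∃ x y z : ℤ, ¬(x = 0 ∧ y = 0 ∧ z = 0) ∧ A * x ^ 2 = B * y ^ 2 + C * z ^ 2 := by
  lift B to ℕ using hB.le
  rcases lt_or_gt_of_ne hA with hA0 | hA0
  · have hC0 : C < 0 := by omega
    obtain ⟨a, rfl⟩ : ∃ a : ℕ, A = -a := ⟨A.natAbs, by omega⟩
    obtain ⟨c, rfl⟩ : ∃ c : ℕ, C = -c := ⟨C.natAbs, by omega⟩
    rw [IsCoprime.neg_left_iff] at hAB hAC
    rw [IsCoprime.neg_right_iff, Nat.isCoprime_iff_coprime] at hAC hBC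
    rw [Nat.isCoprime_iff_coprime] at hAB
    obtain ⟨x, y, z, hne, h⟩ := legendre_ternary_pos a B c (by omega) (by omega) (by omega) hAB hAC
      hBC (by simpa [← sub_eq_add_neg] using h1) (by simpa using h2) (by simpa using h3)
    exact ⟨x, y, z, hne, by linarith⟩
  · lift A to ℕ using hA0.le
    rcases lt_or_gt_of_ne hC with hC0 | hC0
    · obtain ⟨c, rfl⟩ : ∃ c : ℕ, C = -c := ⟨C.natAbs, by omega⟩
      rw [IsCoprime.neg_right_iff, Nat.isCoprime_iff_coprime] at hAC hBC
      rw [Nat.isCoprime_iff_coprime] at hAB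
      obtain ⟨x, y, z, hne, h⟩ := legendre_ternary_pos A c B (by omega) (by omega) (by omega) hAC hAB
        hBC.symm (by simpa [← sub_eq_add_neg, mul_comm] using h1) (by simpa using h3)
        (by simpa using h2)
      exact ⟨x, z, y, by tauto, by linarith⟩
    · lift C to ℕ using hC0.le
      rw [Nat.isCoprime_iff_coprime] at hAB hAC hBC
      obtain ⟨x, y, z, hne, h⟩ := legendre_ternary_pos B C A (by omega) (by omega) (by omega) hBC
        hAB.symm hAC.symm (by simpa [mul_comm] using h2) (by simpa [mul_comm] using h3) h1
      exact ⟨z, x, y, by tauto, by linarith⟩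

/-! ### Auxiliary primes and reciprocity for Jacobi symbols -/

/-- Dirichlet's theorem with an additional odd residue class modulo `8`. -/
theorem exists_prime_gt_and_modEq_and_modEq_eight {N : ℕ} (hN : Odd N) {c : ℤ}
    (hc : IsCoprime c N) {e : ℤ} (he : Odd e) (M : ℕ) :
    ∃ r : ℕ, r.Prime ∧ M < r ∧ (N : ℤ) ∣ r - c ∧ (8 : ℤ) ∣ r - e := by
  have h8 : IsCoprime (8 : ℤ) N := by
    have : Nat.Coprime 8 N := Nat.Coprime.pow_left 3 (Nat.coprime_two_left.2 hN)
    exact_mod_cast Nat.isCoprime_iff_coprime.2 this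
  have he8 : IsCoprime e 8 := by
    have h2 : IsCoprime e 2 := by
      obtain ⟨k, rfl⟩ := he
      exact ⟨1, -k, by ring⟩
    have := h2.pow_right (n := 3)
    norm_num at this
    exact this
  obtain ⟨u, v, huv⟩ := h8
  have hx8 : (8 : ℤ) ∣ (c * (u * 8) + e * (v * N)) - e :=
    ⟨(c - e) * u, by linear_combination e * huv⟩
  have hxN : (N : ℤ) ∣ (c * (u * 8) + e * (v * N)) - c :=
    ⟨(e - c) * v, by linear_combination c * huv⟩
  generalize c * (u * 8) + e * (v * N) = x at hx8 hxN
  have hx : IsCoprime x ((N * 8 : ℕ) : ℤ) := by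
    push_cast
    apply IsCoprime.mul_right
    · obtain ⟨t, ht⟩ := hxN
      rw [show x = c + N * t by linarith]
      exact hc.add_mul_left_left t
    · obtain ⟨t, ht⟩ := hx8
      rw [show x = e + 8 * t by linarith]
      exact he8.add_mul_left_left t
  have hN0 : N * 8 ≠ 0 := by
    have := hN.pos
    positivity
  obtain ⟨r, hrM, hr, hrx⟩ := Nat.forall_exists_prime_gt_and_zmodEq M hN0 hx
  have hd : ((N * 8 : ℕ) : ℤ) ∣ r - x := hrx.symm.dvd
  push_cast at hd
  refine ⟨r, hr, hrM, ?_, ?_⟩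
  · have := (Dvd.intro _ rfl).trans hd |>.add hxN
    simpa using this
  · have := (Dvd.intro_left _ rfl).trans hd |>.add hx8
    simpa using this

theorem jacobiSym.congr_left {a b : ℤ} {n N : ℕ} (hn : n ∣ N) (h : (N : ℤ) ∣ a - b) :
    J(a | n) = J(b | n) :=
  jacobiSym.mod_left' (Int.ModEq.symm (Int.modEq_iff_dvd.2
    ((Int.natCast_dvd_natCast.2 hn).trans h)))

theorem jacobiSym.eq_of_one_mod_four {E : ℤ} (hE : Odd E) {r : ℕ} (hr : r % 4 = 1) :
    J(E | r) = J(r | E.natAbs) := by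
  have hr' : Odd r := Nat.odd_iff.2 (by omega)
  rw [← jacobiSym.quadratic_reciprocity_one_mod_four' (Int.natAbs_odd.2 hE) hr]
  rcases Int.natAbs_eq E with h | h
  · rw [← h]
  · conv_lhs => rw [h]
    rw [jacobiSym.neg _ hr', ZMod.χ₄_nat_one_mod_four hr, one_mul]

/-- There is a prime `r` in a given residue class with `(E / r) = 1`, provided this is compatible
with quadratic reciprocity when `E ≡ 1` modulo `4`. -/
theorem exists_prime_jacobiSym_eq_one {E E' : ℤ} (hE' : Odd E') (hE : E = E' ∨ E = 2 * E')
    {N : ℕ} (hN : Odd N) (hEN : E'.natAbs ∣ N) {c : ℤ} (hc : IsCoprime c N)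
    (h1 : E % 4 = 1 → J(c | E.natAbs) = 1) (M : ℕ) :
    ∃ r : ℕ, r.Prime ∧ M < r ∧ Odd r ∧ (N : ℤ) ∣ r - c ∧ J(E | r) = 1 := by
  have key {r : ℕ} (hr : r % 4 = 1) (h : (N : ℤ) ∣ r - c) : J(E' | r) = J(c | E'.natAbs) := by
    rw [jacobiSym.eq_of_one_mod_four hE' hr, jacobiSym.congr_left hEN h]
  have hpm : J(c | E'.natAbs) = 1 ∨ J(c | E'.natAbs) = -1 := by
    apply jacobiSym.eq_one_or_neg_one
    apply Int.isCoprime_iff_gcd_eq_one.1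
    exact hc.of_isCoprime_of_dvd_right (Int.natCast_dvd_natCast.2 hEN)
  -- The class of `r` modulo `8` is still free, and it decides `(-1 / r)`, `(2 / r)` and the
  -- reciprocity sign; it is chosen to correct the value of `J(c | |E'|)`.
  have ex {e : ℤ} (he : Odd e) := exists_prime_gt_and_modEq_and_modEq_eight hN hc he M
  obtain ⟨r₁, hr₁, hM₁, hN₁, h8₁⟩ := ex (e := 1) (by decide)
  have o₁ : Odd r₁ := Nat.odd_iff.2 (by omega)
  obtain ⟨r₃, hr₃, hM₃, hN₃, h8₃⟩ := ex (e := 3) (by decide)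
  have o₃ : Odd r₃ := Nat.odd_iff.2 (by omega)
  obtain ⟨r₅, hr₅, hM₅, hN₅, h8₅⟩ := ex (e := 5) (by decide)
  have o₅ : Odd r₅ := Nat.odd_iff.2 (by omega)
  rcases hE with rfl | rfl
  · rcases hpm with h | h
    · exact ⟨r₁, hr₁, hM₁, o₁, hN₁, by rw [key (by omega) hN₁, h]⟩
    -- Here `E ≡ 3` modulo `4`, so `r ≡ 3` modulo `4` flips the sign: through reciprocity if `E >
    -- 0`, through `(-1 / r)` if `E < 0`.
    · refine ⟨r₃, hr₃, hM₃, o₃, hN₃, ?_⟩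
      have hE3 : E % 4 = 3 := by
        have : E % 4 ≠ 1 := fun h' => by rw [h1 h'] at h; exact absurd h (by decide)
        have := Int.odd_iff.1 hE'
        omega
      have hr3 : r₃ % 4 = 3 := by omega
      rw [← jacobiSym.congr_left hEN hN₃] at h
      rcases Int.natAbs_eq E with h' | h'
      · rw [h', jacobiSym.quadratic_reciprocity_three_mod_four (by omega) hr3, h]
        norm_num
      · rw [h', jacobiSym.neg _ o₃, ZMod.χ₄_nat_three_mod_four hr3,
          jacobiSym.quadratic_reciprocity_one_mod_four (by omega) o₃, h]
        norm_num
  · rcases hpm with h | h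
    · refine ⟨r₁, hr₁, hM₁, o₁, hN₁, ?_⟩
      rw [jacobiSym.mul_left, key (by omega) hN₁, h, jacobiSym.at_two o₁,
        ZMod.χ₈_nat_eq_if_mod_eight]
      have : r₁ % 8 = 1 := by omega
      simp [this]
      omega
    -- For even `E` the factor `(2 / r) = -1` compensates, while `r ≡ 1` modulo `4` keeps
    -- reciprocity free of signs.
    · refine ⟨r₅, hr₅, hM₅, o₅, hN₅, ?_⟩
      rw [jacobiSym.mul_left, key (by omega) hN₅, h, jacobiSym.at_two o₅,
        ZMod.χ₈_nat_eq_if_mod_eight]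
      have : r₅ % 8 = 5 := by omega
      simp [this]
      omega

/-- Quadratic reciprocity for `D = σ n` with `D ≡ 1` modulo `4`. -/
theorem jacobiSym.neg_sign_mul {σ : ℤ} (hσ : σ = 1 ∨ σ = -1) {n a : ℕ} (hn : (σ * n) % 4 = 1)
    (ha : Odd a) : J(-σ * a | n) = J(σ * n | a) := by
  have hn' : Odd n := by rcases hσ with rfl | rfl <;> exact Nat.odd_iff.2 (by omega)
  rcases hσ with rfl | rfl
  · have hn1 : n % 4 = 1 := by omega
    rw [neg_one_mul, jacobiSym.neg _ hn', ZMod.χ₄_nat_one_mod_four hn1, one_mul, one_mul,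
      jacobiSym.quadratic_reciprocity_one_mod_four' ha hn1]
  · have hn3 : n % 4 = 3 := by omega
    rw [neg_neg, one_mul, neg_one_mul, jacobiSym.neg _ ha]
    rcases Nat.odd_mod_four_iff.1 (Nat.odd_iff.1 ha) with h | h
    · rw [ZMod.χ₄_nat_one_mod_four h, jacobiSym.quadratic_reciprocity_one_mod_four h hn', one_mul]
    · rw [ZMod.χ₄_nat_three_mod_four h, jacobiSym.quadratic_reciprocity_three_mod_four h hn3]
      ring

/-- If `q ≡ 1` modulo `4` this reduces to `jacobiSym.neg_sign_mul`. If `q ≡ 3`, either `n ≡ 3` and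
`(-1 / n)` cancels the reciprocity sign, or `σ = -1`, `n ≡ 1` and no sign occurs. -/
theorem jacobiSym.neg_sign_mul_mul {σ : ℤ} (hσ : σ = 1 ∨ σ = -1) {n q : ℕ}
    (hq : Odd q) (hnq : n.Coprime q) (hn : (σ * n * q) % 4 = 1) :
    J(-σ * q | n) * J(n | q) = 1 := by
  have hsq : J((n : ℤ) | q) * J((n : ℤ) | q) = 1 := by
    have := jacobiSym.sq_one (a := n) (b := q) (by simpa using hnq)
    rwa [sq] at this
  rcases Nat.odd_mod_four_iff.1 (Nat.odd_iff.1 hq) with h | h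
  · have hq4 : (q : ℤ) % 4 = 1 := by omega
    have : (σ * n) % 4 = 1 := by
      rw [Int.mul_emod, hq4] at hn
      omega
    rw [jacobiSym.neg_sign_mul hσ this hq, jacobiSym.mul_left]
    have : J(σ | q) = 1 := by
      rcases hσ with rfl | rfl
      · exact jacobiSym.one_left q
      · rw [jacobiSym.at_neg_one hq, ZMod.χ₄_nat_one_mod_four h]
    rw [this, one_mul, hsq]
  · have hq4 : (q : ℤ) % 4 = 3 := by omega
    have hσn : (σ * n) % 4 = 3 := by
      rw [Int.mul_emod, hq4] at hn
      omega
    rcases hσ with rfl | rfl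
    · have hn3 : n % 4 = 3 := by omega
      have hn' : Odd n := Nat.odd_iff.2 (by omega)
      rw [neg_one_mul, jacobiSym.neg _ hn', ZMod.χ₄_nat_three_mod_four hn3,
        jacobiSym.quadratic_reciprocity_three_mod_four h hn3]
      linarith
    · have hn1 : n % 4 = 1 := by omega
      rw [neg_neg, one_mul, jacobiSym.quadratic_reciprocity_one_mod_four' hq hn1, hsq]

theorem exists_sq_sub_dvd_mul {a b t : ℤ} (hab : IsCoprime a b) (ha : ∃ k, a ∣ k ^ 2 - t)
    (hb : ∃ k, b ∣ k ^ 2 - t) : ∃ k, a * b ∣ k ^ 2 - t := by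
  obtain ⟨k, x, hk⟩ := ha
  obtain ⟨l, y, hl⟩ := hb
  obtain ⟨u, v, huv⟩ := id hab
  have h1 : l * (u * a) + k * (v * b) = k + a * (u * (l - k)) := by linear_combination k * huv
  have h2 : l * (u * a) + k * (v * b) = l + b * (v * (k - l)) := by linear_combination l * huv
  refine ⟨l * (u * a) + k * (v * b), hab.mul_dvd ?_ ?_⟩
  · rw [h1]
    exact ⟨x + 2 * k * (u * (l - k)) + a * (u * (l - k)) ^ 2, by linear_combination hk⟩
  · rw [h2]
    exact ⟨y + 2 * l * (v * (k - l)) + b * (v * (k - l)) ^ 2, by linear_combination hl⟩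

theorem exists_sq_sub_dvd_of_jacobiSym {r : ℕ} (hr : r.Prime) {t : ℤ} (h : J(t | r) = 1) :
    ∃ k, (r : ℤ) ∣ k ^ 2 - t := by
  have : Fact r.Prime := ⟨hr⟩
  obtain ⟨k, hk⟩ := ZMod.isSquare_of_jacobiSym_eq_one h
  refine ⟨k.val, ?_⟩
  rw [← ZMod.intCast_zmod_eq_zero_iff_dvd]
  push_cast
  rw [hk, ZMod.natCast_zmod_val]
  ring

theorem exists_int_crt_three {a b c : ℤ} (hab : IsCoprime a b) (hac : IsCoprime a c)
    (hbc : IsCoprime b c) (x y z : ℤ) :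
    ∃ t : ℤ, a ∣ t - x ∧ b ∣ t - y ∧ c ∣ t - z := by
  obtain ⟨u, v, huv⟩ := hab.mul_right hac
  obtain ⟨u', v', huv'⟩ := hbc
  refine ⟨x * (v * (b * c)) + (y * (v' * c) + z * (u' * b)) * (u * a), ?_, ?_, ?_⟩
  · exact ⟨(y * (v' * c) + z * (u' * b)) * u - x * u, by linear_combination x * huv⟩
  · refine ⟨x * v * c + (z - y) * u' * (u * a) - y * v * c, ?_⟩
    linear_combination y * u * a * huv' + y * huv
  · refine ⟨x * v * b + (y - z) * v' * (u * a) - z * v * b, ?_⟩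
    linear_combination z * u * a * huv' + z * huv

theorem IsCoprime.of_dvd_sub {x y N : ℤ} (h : N ∣ x - y) (hy : IsCoprime y N) :
    IsCoprime x N := by
  obtain ⟨t, ht⟩ := h
  rw [show x = y + N * t by linarith]
  exact hy.add_mul_left_left t

/-! ### Two conics linked by an auxiliary prime -/

/-- Two conics with a common coefficient `s = ± r`, `r` an auxiliary prime, both with a rational
point. The parameters satisfy `P ∈ {1, p}` and `{Q, Q'} = {1, q}`. -/
theorem exists_linked_conics {p q P Q Q' : ℕ} (hp : p.Prime) (hq : q.Prime) (hpq : p ≠ q)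
    (hp4 : p % 4 = 1) (hqodd : Odd q) (hP : P = 1 ∨ P = p) (hQ : Q = 1 ∧ Q' = q ∨ Q = q ∧ Q' = 1)
    {D : ℤ} (hD : Squarefree D) (hDp : IsCoprime D p) (hDq : IsCoprime D q)
    (h1 : J(D * Q' | P) = 1) (h2 : J(D * P | Q') = 1) :
    ∃ s : ℤ, s ≠ 0 ∧ (∃ w x u : ℤ, ¬(w = 0 ∧ x = 0 ∧ u = 0) ∧
        D * w ^ 2 = (P * Q) * x ^ 2 + (Q' * s) * u ^ 2) ∧
      ∀ τ : ℤ, τ = 1 ∨ τ = -1 → ∃ y z v : ℤ, ¬(y = 0 ∧ z = 0 ∧ v = 0) ∧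
        1 * y ^ 2 = p * z ^ 2 + (τ * s) * v ^ 2 := by
  have hD0 : D ≠ 0 := hD.ne_zero
  obtain ⟨σ, n, hσ, hDσ⟩ : ∃ (σ : ℤ) (n : ℕ), (σ = 1 ∨ σ = -1) ∧ D = σ * n := by
    rcases Int.natAbs_eq D with h | h
    · exact ⟨1, D.natAbs, Or.inl rfl, by rw [one_mul]; exact h⟩
    · exact ⟨-1, D.natAbs, Or.inr rfl, by rw [neg_one_mul]; exact h⟩
  have hσu : IsUnit σ := by rcases hσ with rfl | rfl <;> simp
  have hσ2 : σ * σ = 1 := by rcases hσ with rfl | rfl <;> norm_num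
  have hσc (t : ℤ) : IsCoprime σ t := ⟨σ, 0, by linear_combination hσ2⟩
  have hσD : σ * D = n := by rw [hDσ]; linear_combination n * hσ2
  have hDabs : D.natAbs = n := by
    rw [hDσ, Int.natAbs_mul, Int.natAbs_of_isUnit hσu, one_mul, Int.natAbs_natCast]
  have hpodd : Odd p := Nat.odd_iff.2 (by omega)
  have hPodd : Odd P := by rcases hP with rfl | rfl; exacts [odd_one, hpodd]
  have hP4 : P % 4 = 1 := by rcases hP with rfl | rfl; exacts [rfl, hp4]
  have hPp : P ∣ p := by rcases hP with rfl | rfl <;> simp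
  have hQodd : Odd Q := by rcases hQ with ⟨rfl, rfl⟩ | ⟨rfl, rfl⟩; exacts [odd_one, hqodd]
  have hQq : Q * Q' = q := by rcases hQ with ⟨rfl, rfl⟩ | ⟨rfl, rfl⟩ <;> simp
  have hQQ' : IsCoprime (Q : ℤ) Q' := by
    rcases hQ with ⟨rfl, rfl⟩ | ⟨rfl, rfl⟩ <;> simp [isCoprime_one_left, isCoprime_one_right]
  have hpq' : IsCoprime (p : ℤ) q := Nat.isCoprime_iff_coprime.2 ((Nat.coprime_primes hp hq).2 hpq)
  have hPpz : (P : ℤ) ∣ p := Int.natCast_dvd_natCast.2 hPp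
  have hQz : (Q : ℤ) ∣ q := Int.natCast_dvd_natCast.2 (Dvd.intro _ hQq)
  have hQz' : (Q' : ℤ) ∣ q := Int.natCast_dvd_natCast.2 (Dvd.intro_left _ hQq)
  have hnD : ∀ {t : ℤ}, IsCoprime D t → IsCoprime (n : ℤ) t := fun {t} h => by
    rw [hDσ] at h; exact h.of_mul_left_right
  -- the odd part of `D`
  obtain ⟨D', hD'odd, hDD'⟩ : ∃ D' : ℤ, Odd D' ∧ (D = D' ∨ D = 2 * D') := by
    rcases Int.even_or_odd D with ⟨k, hk⟩ | h
    · refine ⟨k, ?_, Or.inr (by rw [hk]; ring)⟩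
      by_contra hk'
      rw [Int.not_odd_iff_even] at hk'
      obtain ⟨j, hj⟩ := hk'
      have : (2 : ℤ) * 2 ∣ D := ⟨j, by rw [hk, hj]; ring⟩
      exact absurd (hD 2 this) (by decide)
    · exact ⟨D, h, Or.inl rfl⟩
  have hD'D : D' ∣ D := by rcases hDD' with h | h <;> rw [h]; exact Dvd.intro_left _ rfl
  set m := D'.natAbs with hm
  have hmodd : Odd m := Int.natAbs_odd.2 hD'odd
  have hmD : (m : ℤ) ∣ D := (Int.natAbs_dvd.2 dvd_rfl).trans hD'D
  have hmp : IsCoprime (m : ℤ) p := hDp.of_isCoprime_of_dvd_left hmD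
  have hmq : IsCoprime (m : ℤ) q := hDq.of_isCoprime_of_dvd_left hmD
  have hmQ : IsCoprime (m : ℤ) Q := hmq.of_isCoprime_of_dvd_right hQz
  have hpQ : IsCoprime (p : ℤ) Q := hpq'.of_isCoprime_of_dvd_right hQz
  -- The class of the future prime `r`, with `s = σ * r`: the residue modulo `p` serves the second
  -- conic and the primes dividing `P`; the one modulo `m` makes `-PQ * Q's` the square `(Pq)²`; the
  -- one modulo `Q` makes `D * s` the square `(σD)²` when `Q = q`.
  obtain ⟨c, hc1, hc2, hc3⟩ := exists_int_crt_three hmp.symm hpQ hmQ 1 (-σ * (P * q : ℕ)) (σ * D)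
  have hcp : IsCoprime c p := IsCoprime.of_dvd_sub hc1 isCoprime_one_left
  have hcm : IsCoprime c m := by
    refine IsCoprime.of_dvd_sub hc2 ?_
    push_cast
    refine IsCoprime.mul_left ?_ (IsCoprime.mul_left ?_ hmq.symm)
    · exact (hσc _).neg_left
    · exact (hmp.of_isCoprime_of_dvd_right hPpz).symm
  have hcQ : IsCoprime c Q := by
    refine IsCoprime.of_dvd_sub hc3 ?_
    exact (hσc _).mul_left (hDq.of_isCoprime_of_dvd_right hQz)
  have hN : Odd (p * (m * Q)) := hpodd.mul (hmodd.mul hQodd)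
  have hcN : IsCoprime c ((p * (m * Q) : ℕ) : ℤ) := by
    push_cast
    exact hcp.mul_right (hcm.mul_right hcQ)
  -- The compatibility needed for `(DQ / r) = 1`. As in the product formula, it follows from the
  -- other local conditions, namely `h1`, `h2` and the choice of `c`.
  have hrec : (D * Q) % 4 = 1 → J(c | (D * Q).natAbs) = 1 := by
    intro hDQ
    have hDm : m = n := by
      rcases hDD' with h | h
      · rw [← hDabs, h]
      · rw [h, mul_assoc] at hDQ
        omega
    have hP0 : P ≠ 0 := hPodd.pos.ne'
    have hq0 : q ≠ 0 := hq.ne_zero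
    have hn0 : n ≠ 0 := by rw [← hDabs]; exact Int.natAbs_ne_zero.2 hD0
    have hσP : J(σ | P) = 1 := by
      rcases hσ with rfl | rfl
      · exact jacobiSym.one_left P
      · rw [jacobiSym.at_neg_one hPodd, ZMod.χ₄_nat_one_mod_four hP4]
    rw [Int.natAbs_mul, Int.natAbs_natCast, hDabs, jacobiSym.mul_right' _ hn0 hQodd.pos.ne',
      jacobiSym.congr_left (N := m) (by rw [hDm]) hc2, jacobiSym.congr_left dvd_rfl hc3, hσD]
    rcases hQ with ⟨rfl, rfl⟩ | ⟨rfl, rfl⟩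
    · rw [jacobiSym.one_right, mul_one]
      rw [Nat.cast_one, mul_one, hDσ] at hDQ
      rw [jacobiSym.neg_sign_mul hσ hDQ (hPodd.mul hqodd), ← hDσ, jacobiSym.mul_right' _ hP0 hq0]
      rw [jacobiSym.mul_left] at h1 h2
      rw [← jacobiSym.quadratic_reciprocity_one_mod_four hP4 hqodd] at h1
      -- The common value `(P / q) = (q / P)` is a sign; it occurs in both `h1` and `h2` and cancels
      -- from their product.
      rcases Int.isUnit_iff.1 (IsUnit.of_mul_eq_one_right _ h1) with h | h <;> rw [h] at h1 h2
      · linear_combination h1 * J(D | Q') + h2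
      · linear_combination -h1 * J(D | Q') + h2
    · rw [Nat.cast_one, mul_one] at h1
      rw [hDσ, jacobiSym.mul_left, hσP, one_mul] at h1
      have hnodd : Odd n := by rw [← hDm]; exact hmodd
      have hnq : n.Coprime Q := Nat.isCoprime_iff_coprime.1 (hnD hDq)
      rw [hDσ] at hDQ
      have h3 := jacobiSym.neg_sign_mul_mul hσ hqodd hnq hDQ
      rw [show -σ * ((P * Q : ℕ) : ℤ) = P * (-σ * Q) by push_cast; ring, jacobiSym.mul_left,
        jacobiSym.quadratic_reciprocity_one_mod_four hP4 hnodd, h1, one_mul, h3]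
  obtain ⟨r, hr, hrM, hrodd, hrN, hEr⟩ := exists_prime_jacobiSym_eq_one (E := D * Q) (E' := D' * Q)
    (hD'odd.mul ((Int.odd_coe_nat Q).2 hQodd))
    (by rcases hDD' with h | h
        · left; rw [h]
        · right; rw [h]; ring) hN
    (by rw [Int.natAbs_mul, Int.natAbs_natCast]; exact Dvd.intro_left _ rfl)
    hcN hrec (p + q + n)
  push_cast at hrN
  have cop {t : ℕ} (ht0 : 0 < t) (ht : t < r) : IsCoprime (r : ℤ) t :=
    Nat.isCoprime_iff_coprime.2 (Nat.coprime_of_lt_prime ht0.ne' ht hr)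
  have hrp : IsCoprime (r : ℤ) p := cop hp.pos (by omega)
  have hrq : IsCoprime (r : ℤ) q := cop hq.pos (by omega)
  have hrn : IsCoprime (r : ℤ) n :=
    cop (by rw [← hDabs]; exact Int.natAbs_pos.2 hD0) (by omega)
  have hr1 : (p : ℤ) ∣ r - 1 := by
    simpa using ((Dvd.intro _ rfl).trans hrN).add hc1
  have hr2 : (m : ℤ) ∣ r + σ * (P * q) := by
    have := (((Dvd.intro _ rfl).trans (Dvd.intro_left _ rfl)).trans hrN).add hc2
    rwa [sub_add_sub_cancel, Nat.cast_mul, neg_mul, sub_neg_eq_add] at this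
  have hr3 : (Q : ℤ) ∣ r - σ * D := by
    simpa using (((Dvd.intro_left _ rfl).trans (Dvd.intro_left _ rfl)).trans hrN).add hc3
  have hpr : J((p : ℤ) | r) = 1 := by
    rw [jacobiSym.quadratic_reciprocity_one_mod_four hp4 hrodd, jacobiSym.congr_left dvd_rfl hr1,
      jacobiSym.one_left]
  have hPr : J((P : ℤ) | r) = 1 := by
    rcases hP with rfl | rfl
    · rw [Nat.cast_one, jacobiSym.one_left]
    · exact hpr
  have hpm {τ : ℤ} (hτ : τ = 1 ∨ τ = -1) : J(τ | p) = 1 := by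
    rcases hτ with rfl | rfl
    · exact jacobiSym.one_left p
    · rw [jacobiSym.at_neg_one hpodd, ZMod.χ₄_nat_one_mod_four hp4]
  have hσp := hpm hσ
  have hrp1 : J((r : ℤ) | p) = 1 := by
    rw [jacobiSym.congr_left dvd_rfl hr1, jacobiSym.one_left]
  have hr0 : (r : ℤ) ≠ 0 := by exact_mod_cast hr.ne_zero
  have hs0 : σ * r ≠ 0 := mul_ne_zero hσu.ne_zero hr0
  -- Giving `s` the sign of `D` ensures that the first conic has real points.
  refine ⟨σ * r, hs0, ?_, ?_⟩
  · have hQqz : (Q : ℤ) * Q' = q := by exact_mod_cast hQq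
    have hsgn : 0 < D ∨ σ < 0 := by
      rcases hσ with rfl | rfl
      · left
        rw [hDσ, one_mul]
        exact lt_of_le_of_ne (Int.natCast_nonneg n) fun h => hD0 (by rw [hDσ, ← h, mul_zero])
      · exact Or.inr (by norm_num)
    have hrpos : (0 : ℤ) < r := by exact_mod_cast hr.pos
    have hPpos : (0 : ℤ) < P := by exact_mod_cast hPodd.pos
    have hQpos : (0 : ℤ) < Q := by exact_mod_cast hQodd.pos
    have hQ'pos : (0 : ℤ) < Q' := by
      have := hq.pos
      rw [← hQq] at this
      exact_mod_cast pos_of_mul_pos_right this (Nat.zero_le _)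
    have hDr : IsCoprime D r := by
      rw [hDσ]
      exact (hσc _).mul_left hrn.symm
    have hPq : IsCoprime (P : ℤ) q := hpq'.of_isCoprime_of_dvd_left hPpz
    have hPQ : IsCoprime (P : ℤ) Q := hPq.of_isCoprime_of_dvd_right hQz
    have hPQ' : IsCoprime (P : ℤ) Q' := hPq.of_isCoprime_of_dvd_right hQz'
    have hrP : IsCoprime (P : ℤ) r := (hrp.of_isCoprime_of_dvd_right hPpz).symm
    have hrQ : IsCoprime (Q : ℤ) r := (hrq.of_isCoprime_of_dvd_right hQz).symm
    have hrQ' : IsCoprime (Q' : ℤ) r := (hrq.of_isCoprime_of_dvd_right hQz').symm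
    apply legendre_ternary D (P * Q) (Q' * (σ * r)) hD0
    · positivity
    · exact mul_ne_zero hQ'pos.ne' hs0
    · refine hsgn.imp id fun h => mul_neg_of_pos_of_neg hQ'pos (mul_neg_of_neg_of_pos h hrpos)
    · exact (hDp.of_isCoprime_of_dvd_right hPpz).mul_right (hDq.of_isCoprime_of_dvd_right hQz)
    · exact (hDq.of_isCoprime_of_dvd_right hQz').mul_right ((hσc D).symm.mul_right hDr)
    · exact (hPQ'.mul_right ((hσc _).symm.mul_right hrP)).mul_left
        (hQQ'.mul_right ((hσc _).symm.mul_right hrQ))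
    · refine ⟨P * q, ?_⟩
      have hdvd : D ∣ r + σ * (P * q) := by
        -- The congruence is known modulo the odd part of `D`; the possible factor `2` divides a sum
        -- of two odd numbers.
        rcases hDD' with h | h
        · rw [h]; exact Int.natAbs_dvd.1 hr2
        · rw [h]
          refine IsCoprime.mul_dvd ?_ ?_ (Int.natAbs_dvd.1 hr2)
          · obtain ⟨k, hk⟩ := hD'odd
            exact ⟨-k, 1, by rw [hk]; ring⟩
          · apply Even.two_dvd
            have hσo : Odd σ := by rcases hσ with rfl | rfl <;> decide
            exact ((Int.odd_coe_nat r).2 hrodd).add_odd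
              (hσo.mul (((Int.odd_coe_nat P).2 hPodd).mul ((Int.odd_coe_nat q).2 hqodd)))
      have := hdvd.mul_left (P * q * σ)
      rwa [show (P : ℤ) * q * σ * (r + σ * (P * q)) = (P * q) ^ 2 + P * Q * (Q' * (σ * r)) by
        rw [← hQqz]
        linear_combination ((P : ℤ) * (Q * Q')) ^ 2 * hσ2] at this
    · apply exists_sq_sub_dvd_mul hPQ
      · rcases hP with rfl | rfl
        · exact ⟨0, by simp⟩
        · apply exists_sq_sub_dvd_of_jacobiSym hp
          rw [show D * (Q' * (σ * r)) = D * Q' * (σ * r) by ring, jacobiSym.mul_left, h1,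
            jacobiSym.mul_left, hσp, hrp1]
          norm_num
      · rcases hQ with ⟨rfl, rfl⟩ | ⟨rfl, rfl⟩
        · exact ⟨0, by simp⟩
        · refine ⟨σ * D, ?_⟩
          have := hr3.mul_left (-(σ * D))
          rwa [show -(σ * D) * (r - σ * D) = (σ * D) ^ 2 - D * ((1 : ℕ) * (σ * r)) by
            push_cast; ring] at this
    · apply exists_sq_sub_dvd_mul ((hσc _).symm.mul_right hrQ')
      · rcases hQ with ⟨rfl, rfl⟩ | ⟨rfl, rfl⟩
        · apply exists_sq_sub_dvd_of_jacobiSym hq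
          rwa [Nat.cast_one, mul_one]
        · exact ⟨0, by simp⟩
      · simp only [hσu.mul_left_dvd]
        apply exists_sq_sub_dvd_of_jacobiSym hr
        rw [show D * (P * Q) = D * Q * P by ring, jacobiSym.mul_left, hEr, hPr]
        norm_num
  · intro τ hτ
    have hτu : IsUnit τ := by rcases hτ with rfl | rfl <;> simp
    have hτc (t : ℤ) : IsCoprime τ t := ⟨τ, 0, by rcases hτ with rfl | rfl <;> norm_num⟩
    apply legendre_ternary 1 p (τ * (σ * r)) one_ne_zero (by exact_mod_cast hp.pos)
    · exact mul_ne_zero hτu.ne_zero hs0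
    · left; norm_num
    · exact isCoprime_one_left
    · exact isCoprime_one_left
    · exact (hτc _).symm.mul_right ((hσc _).symm.mul_right hrp.symm)
    · exact ⟨0, one_dvd _⟩
    · apply exists_sq_sub_dvd_of_jacobiSym hp
      rw [one_mul, jacobiSym.mul_left, jacobiSym.mul_left, hσp, hrp1, hpm hτ]
      norm_num
    · simp only [hτu.mul_left_dvd, hσu.mul_left_dvd, one_mul]
      exact exists_sq_sub_dvd_of_jacobiSym hr hpr

/-! ### Representing `d` by `⟨p, q, -pq⟩` over the rationals -/

theorem Nat.Prime.eq_zero_of_sq_eq_mul_sq {p : ℕ} (hp : p.Prime) {y z : ℤ}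
    (h : y ^ 2 = p * z ^ 2) : y = 0 ∧ z = 0 := by
  by_cases hz : z = 0
  · subst hz
    simpa using h
  · exfalso
    have hz' : (z : ℚ) ≠ 0 := by exact_mod_cast hz
    have : IsSquare (p : ℚ) := by
      refine ⟨y / z, ?_⟩
      have h' : (y : ℚ) ^ 2 = p * z ^ 2 := by exact_mod_cast h
      field_simp
      linarith
    rw [Rat.isSquare_natCast_iff] at this
    exact hp.prime.irreducible.not_isSquare this

theorem isCoprime_prime_of_not_dvd {p : ℕ} (hp : p.Prime) {d : ℤ} (h : ¬ (p : ℤ) ∣ d) :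
    IsCoprime d p :=
  ((Nat.prime_iff_prime_int.1 hp).coprime_iff_not_dvd.2 h).symm

theorem jacobiSym_eq_neg_one_of_ne_one {p : ℕ} {d : ℤ} (hd : IsCoprime d p)
    (h : J(d | p) ≠ 1) : J(d | p) = -1 :=
  (jacobiSym.eq_one_or_neg_one (Int.isCoprime_iff_gcd_eq_one.1 hd)).resolve_left h

theorem not_dvd_and_squarefree_of_squarefree_mul {p d : ℤ} (hp : Prime p)
    (h : Squarefree (p * d)) : ¬ p ∣ d ∧ Squarefree d := by
  refine ⟨fun ⟨e, he⟩ => hp.not_isUnit (h p ⟨e, by rw [he]; ring⟩), h.of_mul_right⟩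

/-- A squarefree `d` that is not a nonzero square modulo `p` or `q` is represented by the form
`⟨p, q, -pq⟩` over `ℚ`. -/
theorem exists_quaternary_zero_of_one_mod_four {p q : ℕ} (hp : p.Prime) (hq : q.Prime)
    (hpq : p ≠ q) (hp4 : p % 4 = 1) (hqodd : Odd q) (hpq1 : J(p | q) = -1)
    {d : ℤ} (hd : Squarefree d) (hdp : J(d | p) ≠ 1) (hdq : J(d | q) ≠ 1) :
    ∃ w x y z : ℤ, ¬(w = 0 ∧ x = 0 ∧ y = 0 ∧ z = 0) ∧
      d * w ^ 2 = p * x ^ 2 + q * y ^ 2 - p * q * z ^ 2 := by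
  have hqp1 : J(q | p) = -1 := by
    rw [← jacobiSym.quadratic_reciprocity_one_mod_four hp4 hqodd, hpq1]
  have hpp := Nat.prime_iff_prime_int.1 hp
  have hqp := Nat.prime_iff_prime_int.1 hq
  have hp0 := hpp.ne_zero
  have hq0 := hqp.ne_zero
  have hv {y z v : ℤ} (s : ℤ) (hne : ¬(y = 0 ∧ z = 0 ∧ v = 0))
      (h : 1 * y ^ 2 = p * z ^ 2 + s * v ^ 2) : v ≠ 0 := by
    rintro rfl
    obtain ⟨h1, h2⟩ := hp.eq_zero_of_sq_eq_mul_sq (y := y) (z := z) (by linarith)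
    exact hne ⟨h1, h2, rfl⟩
  have hyz {y z v : ℤ} {s : ℤ} (hs : s ≠ 0) (hv : v ≠ 0)
      (h : 1 * y ^ 2 = p * z ^ 2 + s * v ^ 2) : ¬(y = 0 ∧ z = 0) := by
    rintro ⟨rfl, rfl⟩
    have : s * v ^ 2 ≠ 0 := mul_ne_zero hs (pow_ne_zero 2 hv)
    apply this
    linarith
  -- Write `d` as `D`, `pD`, `qD` or `pqD` with `D` prime to `pq`. Dividing the equation by the
  -- common factor fixes `P`, `Q`, `Q'`. Eliminating `s` between the two conics gives the zero; `τ =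
  -- -1` is used when `p ∣ d`, because `p (p z² - y²)` has to be matched with `(p z)² - p y²`.
  by_cases h1 : (p : ℤ) ∣ d
  · obtain ⟨d, rfl⟩ := h1
    obtain ⟨hpd, hd⟩ := not_dvd_and_squarefree_of_squarefree_mul hpp hd
    rw [jacobiSym.mul_left, hpq1] at hdq
    by_cases h2 : (q : ℤ) ∣ d
    · obtain ⟨D, rfl⟩ := h2
      obtain ⟨hqD, hD⟩ := not_dvd_and_squarefree_of_squarefree_mul hqp hd
      obtain ⟨s, hs, ⟨w, x, u, hne, h⟩, hc⟩ := exists_linked_conics (P := 1) (Q := q) (Q' := 1) hp hq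
        hpq hp4 hqodd (Or.inl rfl) (Or.inr ⟨rfl, rfl⟩) hD
        (isCoprime_prime_of_not_dvd hp fun h => hpd (h.mul_left _)) (isCoprime_prime_of_not_dvd hq hqD)
        (jacobiSym.one_right _) (jacobiSym.one_right _)
      obtain ⟨y, z, v, hne', h'⟩ := hc (-1) (Or.inr rfl)
      have hv0 := hv _ hne' h'
      have hyz0 := hyz (by simpa using hs) hv0 h'
      refine ⟨w * v, q * x * v, p * u * z, u * y, ?_, ?_⟩
      · simp only [mul_eq_zero, hv0, hp0, hq0]
        tauto
      · push_cast at h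
        linear_combination p * q * v ^ 2 * h + p * q * u ^ 2 * h'
    · have hdq' := isCoprime_prime_of_not_dvd hq h2
      obtain ⟨s, hs, ⟨w, x, u, hne, h⟩, hc⟩ := exists_linked_conics (P := 1) (Q := 1) (Q' := q) hp hq
        hpq hp4 hqodd (Or.inl rfl) (Or.inl ⟨rfl, rfl⟩) hd
        (isCoprime_prime_of_not_dvd hp hpd) hdq' (jacobiSym.one_right _) (by
          rw [Nat.cast_one, mul_one]
          rcases jacobiSym.eq_one_or_neg_one (Int.isCoprime_iff_gcd_eq_one.1 hdq') with h | h
          · exact h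
          · rw [h] at hdq
            norm_num at hdq)
      obtain ⟨y, z, v, hne', h'⟩ := hc (-1) (Or.inr rfl)
      have hv0 := hv _ hne' h'
      have hyz0 := hyz (by simpa using hs) hv0 h'
      refine ⟨w * v, x * v, p * u * z, u * y, ?_, ?_⟩
      · simp only [mul_eq_zero, hv0, hp0]
        tauto
      · push_cast at h
        linear_combination p * v ^ 2 * h + p * q * u ^ 2 * h'
  · have hdp' := jacobiSym_eq_neg_one_of_ne_one (isCoprime_prime_of_not_dvd hp h1) hdp
    by_cases h2 : (q : ℤ) ∣ d
    · obtain ⟨D, rfl⟩ := h2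
      obtain ⟨hqD, hD⟩ := not_dvd_and_squarefree_of_squarefree_mul hqp hd
      rw [jacobiSym.mul_left, hqp1] at hdp'
      obtain ⟨s, hs, ⟨w, x, u, hne, h⟩, hc⟩ := exists_linked_conics (P := p) (Q := q) (Q' := 1) hp hq
        hpq hp4 hqodd (Or.inr rfl) (Or.inr ⟨rfl, rfl⟩) hD
        (isCoprime_prime_of_not_dvd hp fun h => h1 (h.mul_left _)) (isCoprime_prime_of_not_dvd hq hqD)
        (by rw [Nat.cast_one, mul_one]; linarith) (jacobiSym.one_right _)
      obtain ⟨y, z, v, hne', h'⟩ := hc 1 (Or.inl rfl)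
      have hv0 := hv _ hne' h'
      have hyz0 := hyz (by simpa using hs) hv0 h'
      refine ⟨w * v, q * x * v, u * y, u * z, ?_, ?_⟩
      · simp only [mul_eq_zero, hv0, hq0]
        tauto
      · push_cast at h
        linear_combination q * v ^ 2 * h - q * u ^ 2 * h'
    · have hdq' := jacobiSym_eq_neg_one_of_ne_one (isCoprime_prime_of_not_dvd hq h2) hdq
      obtain ⟨s, hs, ⟨w, x, u, hne, h⟩, hc⟩ := exists_linked_conics (P := p) (Q := 1) (Q' := q) hp hq
        hpq hp4 hqodd (Or.inr rfl) (Or.inl ⟨rfl, rfl⟩) hd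
        (isCoprime_prime_of_not_dvd hp h1) (isCoprime_prime_of_not_dvd hq h2)
        (by rw [jacobiSym.mul_left, hdp', hqp1]; norm_num)
        (by rw [jacobiSym.mul_left, hdq', hpq1]; norm_num)
      obtain ⟨y, z, v, hne', h'⟩ := hc 1 (Or.inl rfl)
      have hv0 := hv _ hne' h'
      have hyz0 := hyz (by simpa using hs) hv0 h'
      refine ⟨w * v, x * v, u * y, u * z, ?_, ?_⟩
      · simp only [mul_eq_zero, hv0]
        tauto
      · push_cast at h
        linear_combination v ^ 2 * h - q * u ^ 2 * h'

theorem exists_quaternary_zero {p q : ℕ} (hp : p.Prime) (hq : q.Prime) (hpodd : Odd p)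
    (hqodd : Odd q) (hpq : p ≠ q) (h4 : p % 4 = 1 ∨ q % 4 = 1) (hpq1 : J(p | q) = -1)
    {d : ℤ} (hd : Squarefree d) (hdp : J(d | p) ≠ 1) (hdq : J(d | q) ≠ 1) :
    ∃ w x y z : ℤ, ¬(w = 0 ∧ x = 0 ∧ y = 0 ∧ z = 0) ∧
      d * w ^ 2 = p * x ^ 2 + q * y ^ 2 - p * q * z ^ 2 := by
  rcases h4 with h4 | h4
  · exact exists_quaternary_zero_of_one_mod_four hp hq hpq h4 hqodd hpq1 hd hdp hdq
  · obtain ⟨w, x, y, z, hne, h⟩ := exists_quaternary_zero_of_one_mod_four hq hp hpq.symm h4 hpodd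
      (by rw [jacobiSym.quadratic_reciprocity_one_mod_four h4 hpodd, hpq1]) hd hdq hdp
    exact ⟨w, y, x, z, by tauto, by linarith⟩

/-! ### Quaternion algebras and their norm forms -/

/-- The norm form of the quaternion algebra `ℍ[K, p, q]` has a nontrivial zero. -/
def IsotropicNorm (K : Type*) [Field K] (p q : K) : Prop :=
  ∃ a b c d : K, ¬(a = 0 ∧ b = 0 ∧ c = 0 ∧ d = 0) ∧
    a ^ 2 - p * b ^ 2 - q * c ^ 2 + p * q * d ^ 2 = 0

theorem QuaternionAlgebra.mul_star_eq {K : Type*} [Field K] {p q : K} (x : ℍ[K, p, q]) :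
    x * star x = ((x.re ^ 2 - p * x.imI ^ 2 - q * x.imJ ^ 2 + p * q * x.imK ^ 2 : K) : ℍ[K, p, q]) ∧
    star x * x =
      ((x.re ^ 2 - p * x.imI ^ 2 - q * x.imJ ^ 2 + p * q * x.imK ^ 2 : K) : ℍ[K, p, q]) := by
  obtain ⟨n, hn⟩ : ∃ n, n = x.re ^ 2 - p * x.imI ^ 2 - q * x.imJ ^ 2 + p * q * x.imK ^ 2 := ⟨_, rfl⟩
  rw [← hn]
  constructor <;> ext <;> simp <;> (try rw [hn]) <;> ring

/-- An element with nonzero norm `n` has the two-sided inverse `n⁻¹ • star a`; if `x ≠ 0` has norm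
zero, then `star x` and `0` both solve `x * y = 0`. -/
theorem isDivisionAlgebra_iff_not_isotropicNorm {K : Type*} [Field K] (p q : K) :
    IsDivisionAlgebra ℍ[K, p, q] ↔ ¬ IsotropicNorm K p q := by
  constructor
  · rintro ⟨-, h⟩ ⟨a, b, c, d, hne, h0⟩
    let x : ℍ[K, p, q] := ⟨a, b, c, d⟩
    have hx : x ≠ 0 := fun hx => hne (by
      simpa [x, QuaternionAlgebra.ext_iff] using hx)
    have h1 : x * star x = 0 := by
      rw [(QuaternionAlgebra.mul_star_eq x).1]
      simp [x, h0]
    have := (h x hx 0).1.unique h1 (mul_zero x)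
    exact hx (star_eq_zero.1 this)
  · intro h
    refine ⟨⟨⟨0, 1, fun h => zero_ne_one (congrArg QuaternionAlgebra.re h)⟩⟩, fun a ha b => ?_⟩
    obtain ⟨h1, h2⟩ := QuaternionAlgebra.mul_star_eq a
    set n := a.re ^ 2 - p * a.imI ^ 2 - q * a.imJ ^ 2 + p * q * a.imK ^ 2 with hn
    have hn0 : n ≠ 0 := fun h0 => h ⟨a.re, a.imI, a.imJ, a.imK, fun h' => ha (by
      simpa [QuaternionAlgebra.ext_iff] using h'), h0⟩
    have e1 : a * (n⁻¹ • star a) = 1 := by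
      rw [mul_smul_comm, h1, ← QuaternionAlgebra.coe_smul, smul_eq_mul, inv_mul_cancel₀ hn0,
        QuaternionAlgebra.coe_one]
    have e2 : (n⁻¹ • star a) * a = 1 := by
      rw [smul_mul_assoc, h2, ← QuaternionAlgebra.coe_smul, smul_eq_mul, inv_mul_cancel₀ hn0,
        QuaternionAlgebra.coe_one]
    refine ⟨⟨(n⁻¹ • star a) * b, ?_, ?_⟩, ⟨b * (n⁻¹ • star a), ?_, ?_⟩⟩
    · simp only [← mul_assoc, e1, one_mul]
    · rintro y rfl
      rw [← mul_assoc, e2, one_mul]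
    · simp only [mul_assoc, e2, mul_one]
    · rintro y rfl
      rw [mul_assoc, e1, mul_one]

theorem IsotropicNorm.map {F K : Type*} [Field F] [Field K] (f : F →+* K) {p q : F}
    (h : IsotropicNorm F p q) : IsotropicNorm K (f p) (f q) := by
  obtain ⟨a, b, c, d, hne, h⟩ := h
  refine ⟨f a, f b, f c, f d, by simpa using hne, ?_⟩
  simpa using congrArg f h

/-! ### Local obstruction at `p` and square roots in the `p`-adic integers -/

theorem PadicInt.exists_eq_mul_of_toZMod_eq_zero {p : ℕ} [Fact p.Prime] {x : ℤ_[p]}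
    (h : PadicInt.toZMod x = 0) : ∃ y, x = p * y := by
  have : x ∈ RingHom.ker (PadicInt.toZMod (p := p)) := h
  rw [PadicInt.ker_toZMod, PadicInt.maximalIdeal_eq_span_p, Ideal.mem_span_singleton] at this
  exact this

theorem PadicInt.toZMod_eq_zero_of_norm {p : ℕ} [Fact p.Prime] {q : ℤ} (hq : legendreSym p q = -1)
    {x y : ℤ_[p]} (h : PadicInt.toZMod (x ^ 2 - (q : ℤ_[p]) * y ^ 2) = 0) :
    (∃ x', x = p * x') ∧ ∃ y', y = p * y' := by
  simp only [map_sub, map_mul, map_pow, map_intCast] at h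
  obtain ⟨h1, h2⟩ := legendreSym.eq_zero_mod_of_eq_neg_one hq h
  exact ⟨exists_eq_mul_of_toZMod_eq_zero h1, exists_eq_mul_of_toZMod_eq_zero h2⟩

/-- If `q` is not a square modulo `p`, the quaternion algebra `(p, q)` is ramified at `p`. -/
theorem not_isotropicNorm_padic {p : ℕ} [Fact p.Prime] {q : ℤ} (hq : legendreSym p q = -1) :
    ¬ IsotropicNorm ℚ_[p] p q := by
  rintro ⟨a, b, c, d, hne, h⟩
  have hp0 : (p : ℤ_[p]) ≠ 0 := by exact_mod_cast (Fact.out : p.Prime).ne_zero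
  -- Dividing by a coordinate `m` of largest norm gives a primitive integral zero, in which one
  -- coordinate is `1`.
  obtain ⟨m, hm0, ha, hb, hc, hd, hm⟩ : ∃ m : ℚ_[p], m ≠ 0 ∧ ‖a‖ ≤ ‖m‖ ∧ ‖b‖ ≤ ‖m‖ ∧ ‖c‖ ≤ ‖m‖ ∧
      ‖d‖ ≤ ‖m‖ ∧ (m = a ∨ m = b ∨ m = c ∨ m = d) := by
    obtain ⟨i, hi⟩ := Finite.exists_max (fun i => ‖(![a, b, c, d] : Fin 4 → ℚ_[p]) i‖)
    refine ⟨![a, b, c, d] i, ?_, hi 0, hi 1, hi 2, hi 3, by fin_cases i <;> simp⟩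
    intro h0
    rw [h0, norm_zero] at hi
    exact hne ⟨norm_le_zero_iff.1 (hi 0), norm_le_zero_iff.1 (hi 1), norm_le_zero_iff.1 (hi 2),
      norm_le_zero_iff.1 (hi 3)⟩
  have lift {x : ℚ_[p]} (hx : ‖x‖ ≤ ‖m‖) : ∃ y : ℤ_[p], (y : ℚ_[p]) * m = x := by
    refine ⟨⟨x / m, ?_⟩, div_mul_cancel₀ x hm0⟩
    rw [norm_div]
    exact div_le_one_of_le₀ hx (norm_nonneg m)
  obtain ⟨a', rfl⟩ := lift ha
  obtain ⟨b', rfl⟩ := lift hb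
  obtain ⟨c', rfl⟩ := lift hc
  obtain ⟨d', rfl⟩ := lift hd
  have hz : a' ^ 2 - p * b' ^ 2 - q * c' ^ 2 + (p : ℤ_[p]) * q * d' ^ 2 = 0 := by
    have : ((a' ^ 2 - p * b' ^ 2 - q * c' ^ 2 + (p : ℤ_[p]) * q * d' ^ 2 : ℤ_[p]) : ℚ_[p]) * m ^ 2 = 0 := by
      rw [← h]; push_cast; ring
    exact PadicInt.ext ((mul_eq_zero.1 this).resolve_right (pow_ne_zero 2 hm0))
  -- Modulo `p` only `a² - q c²` survives, and it is anisotropic, so `p` divides `a'` and `c'`.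
  -- After division by `p` the same applies to `b'` and `d'`, contradicting primitivity.
  obtain ⟨⟨a, rfl⟩, c, rfl⟩ := PadicInt.toZMod_eq_zero_of_norm (x := a') (y := c') hq (by
    rw [show a' ^ 2 - q * c' ^ 2 = p * (b' ^ 2 - q * d' ^ 2) by linear_combination hz, map_mul,
      map_natCast, ZMod.natCast_self, zero_mul])
  have hz' : b' ^ 2 - q * d' ^ 2 = p * (a ^ 2 - q * c ^ 2) := by
    apply mul_left_cancel₀ hp0
    linear_combination -hz
  obtain ⟨⟨b, rfl⟩, d, rfl⟩ := PadicInt.toZMod_eq_zero_of_norm (x := b') (y := d') hq (by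
    rw [hz', map_mul, map_natCast, ZMod.natCast_self, zero_mul])
  have final (t : ℤ_[p]) : m ≠ ((p * t : ℤ_[p]) : ℚ_[p]) * m := by
    intro h
    have h1 : ((p * t : ℤ_[p]) : ℚ_[p]) = 1 := mul_right_cancel₀ hm0 (by rw [← h, one_mul])
    have h2 : (p : ℤ_[p]) * t = 1 := PadicInt.ext h1
    exact PadicInt.p_nonunit (IsUnit.of_mul_eq_one t h2)
  rcases hm with h | h | h | h <;> exact final _ h

/-- Hensel's lemma for `X ^ 2 - d`: at a square root modulo `p` the derivative `2 * k` is a unit, as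
`p` is odd and `k` is nonzero modulo `p`. -/
theorem PadicInt.exists_sq_eq_of_legendreSym {p : ℕ} [Fact p.Prime] (hp : Odd p) {d : ℤ}
    (hd : legendreSym p d = 1) : ∃ z : ℤ_[p], z ^ 2 = d := by
  have hd0 : (d : ZMod p) ≠ 0 := fun h => by
    rw [(legendreSym.eq_zero_iff p d).2 h] at hd; exact zero_ne_one hd
  obtain ⟨k, hk⟩ := (legendreSym.eq_one_iff p hd0).1 hd
  have hk0 : k ≠ 0 := by rintro rfl; exact hd0 (by simpa using hk)
  let f : Polynomial ℤ_[p] := .X ^ 2 - .C (d : ℤ_[p])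
  have hf (x : ℤ_[p]) : f.aeval x = x ^ 2 - d := by simp [f]
  have hf' (x : ℤ_[p]) : f.derivative.aeval x = 2 * x := by
    simp [f, one_add_one_eq_two]
  have ker {x : ℤ_[p]} : ‖x‖ < 1 ↔ PadicInt.toZMod x = 0 := by
    rw [← PadicInt.mem_nonunits, ← IsLocalRing.mem_maximalIdeal, ← PadicInt.ker_toZMod,
      RingHom.mem_ker]
  have h2 : (2 : ZMod p) ≠ 0 := by
    intro h
    have h' : ((2 : ℕ) : ZMod p) = 0 := by exact_mod_cast h
    rw [ZMod.natCast_eq_zero_iff, Nat.dvd_prime Nat.prime_two] at h'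
    rcases h' with rfl | rfl
    · exact (Fact.out : Nat.Prime 1).ne_one rfl
    · exact absurd hp (by decide)
  obtain ⟨z, hz, -⟩ := hensels_lemma (F := f) (a := (k.val : ℤ_[p])) (by
    have e : ‖f.derivative.aeval (k.val : ℤ_[p])‖ = 1 := by
      refine le_antisymm (PadicInt.norm_le_one _) (not_lt.1 fun h => ?_)
      rw [ker, hf'] at h
      rw [map_mul, map_ofNat, map_natCast, ZMod.natCast_zmod_val] at h
      exact mul_ne_zero h2 hk0 h
    rw [e, one_pow, ker, hf]
    simp [hk, sq])
  exact ⟨z, by rw [hf] at hz; exact sub_eq_zero.1 hz⟩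

/-! ### Springer's theorem for diagonal forms -/

section Springer

open Polynomial

variable {F : Type*} [Field F] {ι : Type*} [Fintype ι]

/-- The coefficient of degree `2 * m` is the form evaluated at the coefficients of degree `m`, which
do not all vanish; anisotropy forbids cancellation. Hence values of the form have even degree. -/
theorem Polynomial.natDegree_sum_mul_sq {w : ι → F} (hw : ∀ v : ι → F, ∑ i, w i * v i ^ 2 = 0 → v = 0)
    {v : ι → F[X]} (hv : v ≠ 0) :
    ∃ m, (∀ i, (v i).natDegree ≤ m) ∧ (∃ i, v i ≠ 0 ∧ (v i).natDegree = m) ∧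
      ∑ i, C (w i) * v i ^ 2 ≠ 0 ∧ (∑ i, C (w i) * v i ^ 2).natDegree = 2 * m := by
  obtain ⟨j, hj⟩ := Function.ne_iff.1 hv
  have : Nonempty ι := ⟨j⟩
  obtain ⟨i, hi⟩ := Finite.exists_max fun i => (v i).degree
  have hi0 : v i ≠ 0 := by
    intro h
    have := hi j
    rw [h, degree_zero, le_bot_iff, degree_eq_bot] at this
    exact hj this
  have hle (k : ι) : (v k).natDegree ≤ (v i).natDegree := natDegree_le_natDegree (hi k)
  have hcoeff : (∑ k, C (w k) * v k ^ 2).coeff (2 * (v i).natDegree) ≠ 0 := by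
    simp only [finsetSum_coeff, coeff_C_mul]
    simp only [fun k => coeff_pow_of_natDegree_le (m := 2) (hle k)]
    intro h
    have := congrFun (hw _ h) i
    exact hi0 (leadingCoeff_eq_zero.1 this)
  refine ⟨(v i).natDegree, hle, ⟨i, hi0, rfl⟩, fun h => hcoeff (by rw [h, coeff_zero]), ?_⟩
  refine le_antisymm (natDegree_sum_le_of_forall_le _ _ fun k _ => ?_)
    (le_natDegree_of_ne_zero hcoeff)
  exact (natDegree_C_mul_le _ _).trans (natDegree_pow_le_of_le 2 (hle k))

theorem Polynomial.exists_irreducible_odd_natDegree_dvd (g : F[X]) (hg : Odd g.natDegree) :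
    ∃ h, Irreducible h ∧ Odd h.natDegree ∧ h ∣ g := by
  induction hn : g.natDegree using Nat.strong_induction_on generalizing g with
  | _ n ih =>
    subst hn
    have hg0 : g ≠ 0 := by rintro rfl; simp at hg
    have hu : ¬ IsUnit g := fun h => by
      rw [natDegree_eq_zero_of_isUnit h] at hg; simp at hg
    obtain ⟨h, hh, k, rfl⟩ := WfDvdMonoid.exists_irreducible_factor hu hg0
    by_cases ho : Odd h.natDegree
    · exact ⟨h, hh, ho, Dvd.intro _ rfl⟩
    · have hk0 := right_ne_zero_of_mul hg0
      rw [natDegree_mul hh.ne_zero hk0] at hg ih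
      have hpos := hh.natDegree_pos
      have hk : Odd k.natDegree := by
        rw [Nat.odd_add'] at hg
        exact hg.2 (Nat.not_odd_iff_even.1 ho)
      obtain ⟨l, hl, hl', hlk⟩ := ih k.natDegree (by omega) k hk rfl
      exact ⟨l, hl, hl', hlk.mul_left h⟩

/-- Springer's theorem for diagonal forms, over `F[X]`. -/
theorem Polynomial.dvd_of_dvd_sum_mul_sq {w : ι → F}
    (hw : ∀ v : ι → F, ∑ i, w i * v i ^ 2 = 0 → v = 0) (f : F[X]) (hf : Irreducible f)
    (hodd : Odd f.natDegree) (v : ι → F[X]) (hv : f ∣ ∑ i, C (w i) * v i ^ 2) (i : ι) :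
    f ∣ v i := by
  induction hn : f.natDegree using Nat.strong_induction_on generalizing f v i with
  | _ n ih =>
    subst hn
    -- Descent on the degree bound `m`. If `f * g` is the value at `v`, its degree is even and at
    -- most `2 * m`, so `g` has odd degree less than that of `f`. An odd-degree irreducible factor
    -- `h` of `g` divides every `v i` by the outer induction, and dividing by `h` lowers the bound.
    have key (m : ℕ) : m < f.natDegree → ∀ v : ι → F[X], v ≠ 0 → (∀ i, (v i).natDegree ≤ m) →
        ¬ f ∣ ∑ i, C (w i) * v i ^ 2 := by
      induction m using Nat.strong_induction_on with
      | _ m ihm =>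
        rintro hm v hv0 hdeg ⟨g, hg⟩
        obtain ⟨m', -, ⟨i, hi0, hi⟩, hQ0, hQ⟩ := natDegree_sum_mul_sq hw hv0
        have hm' := hdeg i
        rw [hi] at hm'
        have hg0 : g ≠ 0 := by rintro rfl; rw [mul_zero] at hg; exact hQ0 hg
        rw [hg, natDegree_mul hf.ne_zero hg0] at hQ
        have hgodd : Odd g.natDegree := by
          rw [Nat.odd_iff] at hodd ⊢; omega
        obtain ⟨h, hh, hhodd, k, rfl⟩ := exists_irreducible_odd_natDegree_dvd g hgodd
        have hk0 := right_ne_zero_of_mul hg0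
        rw [natDegree_mul hh.ne_zero hk0] at hQ
        have hlt : h.natDegree < f.natDegree := by omega
        have hdvd : ∀ i, h ∣ v i := fun i =>
          ih h.natDegree hlt h hh hhodd v (by rw [hg]; exact ⟨f * k, by ring⟩) i rfl
        choose u hu using hdvd
        have hu0 : u ≠ 0 := by
          rintro rfl
          exact hi0 (by rw [hu i]; simp)
        have hpos := hh.natDegree_pos
        have hnd {i} (h0 : u i ≠ 0) : h.natDegree + (u i).natDegree ≤ m := by
          have := hdeg i
          rwa [hu i, natDegree_mul hh.ne_zero h0] at this
        have hui0 : u i ≠ 0 := by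
          intro h0; rw [hu i, h0, mul_zero] at hi0; exact hi0 rfl
        have hmpos := hnd hui0
        refine ihm (m - h.natDegree) (by omega) (by omega) u hu0 (fun i => ?_) ?_
        · by_cases h0 : u i = 0
          · simp [h0]
          · have := hnd h0
            omega
        · have hQu : ∑ i, C (w i) * v i ^ 2 = h ^ 2 * ∑ i, C (w i) * u i ^ 2 := by
            rw [Finset.mul_sum]
            refine Finset.sum_congr rfl fun i _ => ?_
            rw [hu i]; ring
          have : f ∣ h ^ 2 * ∑ i, C (w i) * u i ^ 2 := by
            rw [← hQu, hg]; exact Dvd.intro _ rfl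
          refine (hf.prime.dvd_or_dvd this).resolve_left fun hfh => ?_
          have := natDegree_le_of_dvd (hf.prime.dvd_of_dvd_pow hfh) hh.ne_zero
          omega
    -- Reducing `v` modulo `f` brings the degrees below that of `f`, where `key` applies.
    rw [← EuclideanDomain.mod_eq_zero]
    by_contra hne
    refine key (f.natDegree - 1) (by have := hf.natDegree_pos; omega) (fun i => v i % f)
      (fun h => hne (congrFun h i)) (fun i => ?_) ?_
    · have := natDegree_mod_lt (v i) hf.natDegree_pos.ne'
      omega
    · have : f ∣ ∑ i, C (w i) * v i ^ 2 - ∑ i, C (w i) * (v i % f) ^ 2 := by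
        rw [← Finset.sum_sub_distrib]
        refine Finset.dvd_sum fun i _ => ?_
        rw [← mul_sub, sq_sub_sq]
        have : f ∣ v i - v i % f :=
          ⟨v i / f, by linear_combination -(EuclideanDomain.div_add_mod (v i) f)⟩
        exact (this.mul_left _).mul_left _
      exact (dvd_sub_right hv).1 this

/-- Springer's theorem for diagonal forms: anisotropy is preserved in odd degree extensions. -/
theorem springer_diagonal {K : Type*} [Field K] [Algebra F K] [FiniteDimensional F K]
    [Algebra.IsSeparable F K] (hodd : Odd (Module.finrank F K)) {w : ι → F}
    (hw : ∀ v : ι → F, ∑ i, w i * v i ^ 2 = 0 → v = 0) (v : ι → K)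
    (hv : ∑ i, algebraMap F K (w i) * v i ^ 2 = 0) : v = 0 := by
  let pb := Field.powerBasisOfFiniteOfSeparable F K
  choose P hP using fun i => pb.exists_eq_aeval' (v i)
  have hint : IsIntegral F pb.gen := pb.isIntegral_gen
  have hdvd : minpoly F pb.gen ∣ ∑ i, C (w i) * P i ^ 2 := by
    apply minpoly.dvd
    simpa [← hP] using hv
  funext i
  have := dvd_of_dvd_sum_mul_sq hw _ (minpoly.irreducible hint)
    (by rwa [pb.natDegree_minpoly, ← pb.finrank]) P hdvd i
  rw [hP i, Pi.zero_apply, minpoly.dvd_iff.1 this]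

end Springer

theorem IsotropicNorm.of_odd_finrank {F K : Type*} [Field F] [Field K] [Algebra F K]
    [FiniteDimensional F K] [Algebra.IsSeparable F K] (hodd : Odd (Module.finrank F K)) {p q : F}
    (h : IsotropicNorm K (algebraMap F K p) (algebraMap F K q)) : IsotropicNorm F p q := by
  by_contra hF
  obtain ⟨a, b, c, d, hne, h0⟩ := h
  have := springer_diagonal (K := K) hodd (w := ![1, -p, -q, p * q]) (fun v hv => by
    by_contra hv0
    refine hF ⟨v 0, v 1, v 2, v 3, fun hh => hv0 ?_, ?_⟩
    · ext i
      fin_cases i <;> simp [hh]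
    · simp [Fin.sum_univ_four] at hv
      linear_combination hv) ![a, b, c, d] (by
    simp [Fin.sum_univ_four]
    linear_combination h0)
  exact hne ⟨congrFun this 0, congrFun this 1, congrFun this 2, congrFun this 3⟩

/-! ### Quadratic fields: square roots, embeddings and the discriminant -/

section QuadraticField

open Polynomial

variable {F : Type*} [Field F] [NumberField F]

theorem exists_squarefree_sq_eq (hF : Module.finrank ℚ F = 2) :
    ∃ (d : ℤ) (δ : F), Squarefree d ∧ δ ^ 2 = d ∧ ∀ b : ℚ, algebraMap ℚ F b ≠ δ := by
  obtain ⟨θ, hθ⟩ := Field.exists_primitive_element ℚ F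
  have hdeg := (Field.primitive_element_iff_minpoly_natDegree_eq ℚ θ).1 hθ
  rw [hF] at hdeg
  have hint : IsIntegral ℚ θ := IsIntegral.of_finite ℚ θ
  have hθr (b : ℚ) : algebraMap ℚ F b ≠ θ := by
    rintro rfl
    rw [minpoly.eq_X_sub_C, natDegree_X_sub_C] at hdeg
    omega
  have hroot := minpoly.aeval ℚ θ
  rw [aeval_eq_sum_range, hdeg] at hroot
  have hlead : (minpoly ℚ θ).coeff 2 = 1 := by
    rw [← hdeg]; exact (minpoly.monic hint).coeff_natDegree
  simp only [Finset.sum_range_succ, Finset.sum_range_zero, hlead, Algebra.smul_def, map_one] at hroot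
  generalize (minpoly ℚ θ).coeff 1 = u at hroot
  generalize (minpoly ℚ θ).coeff 0 = v at hroot
  obtain ⟨t, ht⟩ : ∃ t : ℚ, t = u ^ 2 - 4 * v := ⟨_, rfl⟩
  have h1 : (2 * θ + algebraMap ℚ F u) ^ 2 = algebraMap ℚ F t := by
    rw [ht]
    simp only [map_sub, map_mul, map_pow, map_ofNat]
    linear_combination 4 * hroot
  have hr1 (b : ℚ) : algebraMap ℚ F b ≠ 2 * θ + algebraMap ℚ F u := by
    intro h
    apply hθr ((b - u) / 2)
    simp only [map_div₀, map_sub, map_ofNat, h]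
    ring
  generalize 2 * θ + algebraMap ℚ F u = δ at h1 hr1
  have hδ0 : δ ≠ 0 := fun h => hr1 0 (by rw [h, map_zero])
  have ht0 : t ≠ 0 := by
    rintro rfl
    rw [map_zero] at h1
    exact hδ0 (pow_eq_zero_iff two_ne_zero |>.1 h1)
  -- An integer in the square class of `t`, since `num * den = t * den²`.
  obtain ⟨N, hN⟩ : ∃ N : ℤ, N = t.num * t.den := ⟨_, rfl⟩
  have hN0 : N ≠ 0 := by
    rw [hN]; exact mul_ne_zero (Rat.num_ne_zero.2 ht0) (by exact_mod_cast t.den_ne_zero)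
  have hNt : (N : ℚ) = t * (t.den : ℚ) ^ 2 := by
    rw [hN]; push_cast
    rw [sq, ← mul_assoc, Rat.mul_den_eq_num]
  obtain ⟨a, s, -, hs, hab, ha⟩ := Nat.sq_mul_squarefree_of_pos (Int.natAbs_pos.2 hN0)
  have hs0 : (s : ℚ) ≠ 0 := by exact_mod_cast hs.ne'
  have hden : (t.den : ℚ) ≠ 0 := by exact_mod_cast t.den_ne_zero
  obtain ⟨d, hd, hdN⟩ : ∃ d : ℤ, Squarefree d ∧ N = s ^ 2 * d := by
    rcases Int.natAbs_eq N with h | h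
    · exact ⟨a, Int.squarefree_natCast.2 ha, by rw [h, ← hab]; push_cast; ring⟩
    · exact ⟨-a, by rw [← Int.squarefree_natAbs, Int.natAbs_neg]; simpa using ha,
        by rw [h, ← hab]; push_cast; ring⟩
  refine ⟨d, algebraMap ℚ F (t.den / s) * δ, hd, ?_, fun b hb => ?_⟩
  · rw [mul_pow, h1, ← map_pow, ← map_mul]
    have : (t.den / s : ℚ) ^ 2 * t = d := by
      have : (s : ℚ) ^ 2 * d = t * t.den ^ 2 := by rw [← hNt, hdN]; push_cast; ring
      field_simp
      linear_combination -this
    rw [this]; simp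
  · apply hr1 (b / (t.den / s))
    rw [map_div₀, hb, mul_div_cancel_left₀]
    rw [_root_.map_ne_zero]
    exact div_ne_zero hden hs0

variable {d : ℤ} {δ : F}

theorem minpoly_eq_of_sq_eq (h : δ ^ 2 = d) (hδ : ∀ b : ℚ, algebraMap ℚ F b ≠ δ) :
    minpoly ℚ δ = X ^ 2 - C (d : ℚ) := by
  symm
  apply minpoly.eq_of_irreducible_of_monic
  · apply X_pow_sub_C_irreducible_of_prime Nat.prime_two
    intro b hb
    have : (algebraMap ℚ F b) ^ 2 = δ ^ 2 := by rw [h, ← map_pow, hb]; simp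
    rcases sq_eq_sq_iff_eq_or_eq_neg.1 this with h' | h'
    · exact hδ b h'
    · exact hδ (-b) (by rw [map_neg, h', neg_neg])
  · simp [h]
  · exact monic_X_pow_sub_C _ two_ne_zero

theorem trace_eq_zero_of_sq_eq (h : δ ^ 2 = d) (hδ : ∀ b : ℚ, algebraMap ℚ F b ≠ δ) :
    Algebra.trace ℚ F δ = 0 := by
  rw [trace_eq_finrank_mul_minpoly_nextCoeff, minpoly_eq_of_sq_eq h hδ]
  have : (X ^ 2 - C (d : ℚ)).natDegree = 2 := natDegree_X_pow_sub_C
  rw [nextCoeff_of_natDegree_pos (by omega), this]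
  simp only [coeff_sub, coeff_X_pow, coeff_C]
  norm_num

theorem nonempty_ringHom_of_sq_eq (hF : Module.finrank ℚ F = 2) (h : δ ^ 2 = d)
    (hδ : ∀ b : ℚ, algebraMap ℚ F b ≠ δ) {L : Type*} [Field L] [Algebra ℚ L] {z : L}
    (hz : z ^ 2 = d) : Nonempty (F →+* L) := by
  have htop : IntermediateField.adjoin ℚ {δ} = ⊤ := by
    rw [Field.primitive_element_iff_minpoly_natDegree_eq, minpoly_eq_of_sq_eq h hδ,
      natDegree_X_pow_sub_C, hF]
  obtain ⟨φ⟩ := IntermediateField.nonempty_algHom_of_adjoin_splits (F := ℚ) (E := F) (K := L)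
    (S := {δ}) (by
      rintro s rfl
      refine ⟨IsIntegral.of_finite ℚ s, ?_⟩
      rw [minpoly_eq_of_sq_eq h hδ]
      have : (X ^ 2 - C (d : ℚ)).map (algebraMap ℚ L) = (X - C z) * (X - C (-z)) := by
        rw [Polynomial.map_sub, Polynomial.map_pow, map_X, Polynomial.map_C, map_intCast, ← hz, C_neg,
          C_pow]
        ring
      rw [this]
      exact (Splits.X_sub_C _).mul (Splits.X_sub_C _)) htop
  exact ⟨φ.toRingHom⟩

/-- The family `1, δ` has trace matrix `diag(2, 2d)`, hence discriminant `4d`; `k` is the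
determinant expressing it in an integral basis. -/
theorem exists_four_mul_eq_sq_mul_discr (hF : Module.finrank ℚ F = 2) (h : δ ^ 2 = d)
    (hδ : ∀ b : ℚ, algebraMap ℚ F b ≠ δ) :
    ∃ k : ℤ, 4 * d = k ^ 2 * NumberField.discr F := by
  have hint : IsIntegral ℤ δ := by
    refine ⟨X ^ 2 - C d, monic_X_pow_sub_C _ two_ne_zero, ?_⟩
    rw [eval₂_sub, eval₂_X_pow, eval₂_C, h, eq_intCast, sub_self]
  let ε : 𝓞 F := ⟨δ, hint⟩
  have hε : ε * ε = (d : 𝓞 F) := by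
    apply NumberField.RingOfIntegers.ext
    push_cast
    rw [← sq]
    exact h
  have hcard : Fintype.card (Module.Free.ChooseBasisIndex ℤ (𝓞 F)) = 2 := by
    rw [← Module.finrank_eq_card_chooseBasisIndex, NumberField.RingOfIntegers.rank, hF]
  let b := (NumberField.RingOfIntegers.basis F).reindex (Fintype.equivFinOfCardEq hcard)
  have hdisc : Algebra.discr ℤ b = NumberField.discr F := NumberField.discr_eq_discr F b
  have htr : Algebra.trace ℤ (𝓞 F) ε = 0 := by
    have := Algebra.coe_trace_int (K := F) ε
    rw [show ((ε : 𝓞 F) : F) = δ from rfl, trace_eq_zero_of_sq_eq h hδ] at this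
    exact_mod_cast this
  have htr' (n : ℤ) : Algebra.trace ℤ (𝓞 F) (n : 𝓞 F) = 2 * n := by
    have := Algebra.trace_algebraMap (S := 𝓞 F) n
    rw [NumberField.RingOfIntegers.rank, hF] at this
    simpa using this
  refine ⟨(b.toMatrix ![1, ε]).det, ?_⟩
  rw [← hdisc, ← Algebra.discr_of_matrix_vecMul, Module.Basis.toMatrix_map_vecMul, Algebra.discr_def,
    Matrix.det_fin_two]
  have h1 := htr' 1
  rw [Int.cast_one] at h1
  simp [Algebra.traceMatrix_apply, Algebra.traceForm_apply, hε, htr, htr', h1]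
  ring

theorem legendreSym_discr (hF : Module.finrank ℚ F = 2) (hd : Squarefree d) (h : δ ^ 2 = d)
    (hδ : ∀ b : ℚ, algebraMap ℚ F b ≠ δ) {p : ℕ} [Fact p.Prime] (hp : Odd p) :
    legendreSym p (NumberField.discr F) = legendreSym p d := by
  obtain ⟨k, hk⟩ := exists_four_mul_eq_sq_mul_discr hF h hδ
  have hpp := Nat.prime_iff_prime_int.1 (Fact.out : p.Prime)
  have h2 : ¬ (p : ℤ) ∣ 2 := by
    intro h
    have h : p ∣ 2 := by exact_mod_cast h
    rcases (Nat.dvd_prime Nat.prime_two).1 h with h | h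
    · exact (Fact.out : p.Prime).ne_one h
    · rw [h] at hp
      exact absurd hp (by decide)
  -- Otherwise `p²` would divide `4d`, hence `d`, which is squarefree. So `4` and `k²` are squares
  -- prime to `p` and drop out of the symbols.
  have hkp : ¬ (p : ℤ) ∣ k := by
    rintro ⟨j, rfl⟩
    have h4 : IsCoprime ((p : ℤ) * p) 4 := by
      have := (hpp.coprime_iff_not_dvd.2 h2).pow (m := 2) (n := 2)
      norm_num [sq] at this
      simpa [← sq] using this
    have hdvd : (p : ℤ) * p ∣ 4 * d := ⟨j ^ 2 * NumberField.discr F, by rw [hk]; ring⟩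
    exact hpp.not_isUnit (hd p (h4.dvd_of_dvd_mul_left hdvd))
  have e1 := congrArg (legendreSym p) hk
  rw [legendreSym.mul, legendreSym.mul, legendreSym.sq_one' p (by
      rwa [Ne, ZMod.intCast_zmod_eq_zero_iff_dvd]), one_mul,
    show (4 : ℤ) = 2 ^ 2 by norm_num, legendreSym.sq_one' p (by
      rwa [Ne, ZMod.intCast_zmod_eq_zero_iff_dvd]), one_mul] at e1
  exact e1.symm

end QuadraticField

/-! ### Assembly of the main theorem -/

theorem IsotropicNorm.of_quaternary {F : Type*} [Field F] [CharZero F] {p q : ℕ}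
    {d : ℤ} (hd : d ≠ 0) {δ : F} (hδ : δ ^ 2 = d) {w x y z : ℤ}
    (hne : ¬(w = 0 ∧ x = 0 ∧ y = 0 ∧ z = 0))
    (h : d * w ^ 2 = p * x ^ 2 + q * y ^ 2 - p * q * z ^ 2) : IsotropicNorm F p q := by
  refine ⟨δ * w, x, y, z, ?_, ?_⟩
  · rintro ⟨h1, h2, h3, h4⟩
    rw [Int.cast_eq_zero] at h2 h3 h4
    subst h2 h3 h4
    exact hne ⟨by simpa [hd] using h, rfl, rfl, rfl⟩
  · have h' : (d : F) * w ^ 2 = p * x ^ 2 + q * y ^ 2 - p * q * z ^ 2 := by exact_mod_cast h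
    rw [mul_pow, hδ, h']
    ring

theorem mainTheorem2 (ℓ : ℕ) (hℓ : ℓ.Prime) (hℓodd : Odd ℓ)
    (F : Type*) [Field F] [NumberField F] (hF : Module.finrank ℚ F = 2)
    (K : Type*) [Field K] [NumberField K] [Algebra F K]
    (hK : IsDihedralOver ℓ F K ∨ IsUnramifiedAbelianOver ℓ F K)
    (p q : ℕ) [Fact p.Prime] [Fact q.Prime] (hp : Odd p) (hq : Odd q) (hpq : p ≠ q)
    (hleg : legendreSym q (p : ℤ) = -1) (hmod : p ≡ 1 [MOD 4] ∨ q ≡ 1 [MOD 4]) :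
    IsDivisionAlgebra ℍ[K, (p : K), (q : K)] ↔
      legendreSym p (NumberField.discr F) = 1 ∨ legendreSym q (NumberField.discr F) = 1 := by
  have hodd : Odd (Module.finrank F K) := by
    rcases hK with h | h
    · rw [h.degree]; exact hℓodd
    · obtain ⟨n, -, hn⟩ := h.degree
      rw [hn]; exact hℓodd.pow
  have hfin : FiniteDimensional F K := Module.finite_of_finrank_pos hodd.pos
  have hpP : p.Prime := Fact.out
  have hqP : q.Prime := Fact.out
  have hmod' : p % 4 = 1 ∨ q % 4 = 1 := hmod
  have hleg' : J(p | q) = -1 := by rwa [← jacobiSym.legendreSym.to_jacobiSym]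
  -- Reciprocity has no sign because one of the primes is `1` modulo `4`; hence `p` and `q` play
  -- symmetric roles.
  have hleg'' : legendreSym p (q : ℤ) = -1 := by
    rw [jacobiSym.legendreSym.to_jacobiSym]
    rcases hmod' with h | h
    · rw [← jacobiSym.quadratic_reciprocity_one_mod_four h hq, hleg']
    · rw [jacobiSym.quadratic_reciprocity_one_mod_four h hp, hleg']
  obtain ⟨d, δ, hd, hδ, hδr⟩ := exists_squarefree_sq_eq hF
  rw [legendreSym_discr hF hd hδ hδr hp, legendreSym_discr hF hd hδ hδr hq,
    isDivisionAlgebra_iff_not_isotropicNorm]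
  have hFK : IsotropicNorm K (p : K) (q : K) ↔ IsotropicNorm F (p : F) (q : F) := by
    constructor
    · intro h
      apply IsotropicNorm.of_odd_finrank (K := K) hodd
      simpa using h
    · intro h
      simpa using h.map (algebraMap F K)
  rw [hFK]
  constructor
  · intro h
    by_contra! hne
    rw [jacobiSym.legendreSym.to_jacobiSym, jacobiSym.legendreSym.to_jacobiSym] at hne
    obtain ⟨w, x, y, z, hwxyz, h'⟩ := exists_quaternary_zero hpP hqP hp hq hpq hmod' hleg' hd hne.1 hne.2
    exact h (IsotropicNorm.of_quaternary hd.ne_zero hδ hwxyz h')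
  · rintro (h | h) hF'
    · obtain ⟨z, hz⟩ := PadicInt.exists_sq_eq_of_legendreSym hp h
      obtain ⟨φ⟩ := nonempty_ringHom_of_sq_eq hF hδ hδr (L := ℚ_[p]) (z := z)
        (by exact_mod_cast congrArg ((↑) : ℤ_[p] → ℚ_[p]) hz)
      have := hF'.map φ
      simp only [map_natCast] at this
      exact not_isotropicNorm_padic hleg'' (by simpa using this)
    · obtain ⟨z, hz⟩ := PadicInt.exists_sq_eq_of_legendreSym hq h
      obtain ⟨φ⟩ := nonempty_ringHom_of_sq_eq hF hδ hδr (L := ℚ_[q]) (z := z)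
        (by exact_mod_cast congrArg ((↑) : ℤ_[q] → ℚ_[q]) hz)
      obtain ⟨a, b, c, e, hne, h0⟩ := hF'.map φ
      simp only [map_natCast] at h0
      -- Swapping the middle coordinates exchanges `p` and `q` in the norm form.
      exact not_isotropicNorm_padic hleg ⟨a, c, b, e, by tauto, by
        push_cast; linear_combination h0⟩
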